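/- Let $m\ge 1$ and let $\mathbb{R}_m$ be the real Clifford algebra generated by $e_1,\dots,e_m$ with $e_j^2=-1$ and $e_ie_j=-e_je_i$ for $i\ne j$, with basis $e_A=e_{j_1}\cdots e_{j_h}$ ($A=\{j_1<\dots<j_h\}\subseteq\{1,\dots,m\}$) and norm $|\lambda|^2=[\bar\lambda\lambda]_0=\sum_A\lambda_A^2$ for $\lambda=\sum_A\lambda_Ae_A$, where $\lambda\mapsto\bar\lambda$ is the linear anti-automorphism with $\overline{e_j}=-e_j$ and $[\cdot]_0$ is the scalar part. A vector $x\in\mathbb{R}^m$ is identified with $\sum_j x_je_j$, so that $x^2=-|x|^2$. Let $\partial_x=\sum_{j=1}^m e_j\partial_{x_j}$ be the Dirac operator, acting from the left on $\mathbb{R}_m$-valued functions, let $B(1)=\{x\in\mathbb{R}^m:|x|\le 1\}$, and for $\alpha>-1$ put $$D_\alpha f(x)=(1+x^2)^{-\alpha}\,\partial_x\big((1+x^2)^{\alpha+1}f(x)\big)$$ for functions $f$ on $B(1)$. Let $n,k\ge 0$ be integers and let $Y_k:\mathbb{R}^m\to\mathbb{R}_m$ be a left spherical monogenic of order $k$,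 i.e. an $\mathbb{R}_m$-valued homogeneous polynomial of degree $k$ with $\partial_xY_k=0$, normalized by $$\int_{S^{m-1}}|Y_k(\theta)|^2\,d\theta=1$$ with respect to the (unnormalized) surface measure; for example, $Y_k=Y_k^i$ is a member of a basis of the space of left spherical monogenics of order $k$ that is orthonormal for $\int_{S^{m-1}}\overline{Y(\theta)}Y'(\theta)\,d\theta$. Let $$C_{n,m}^0(Y_k)=D_0D_1\cdots D_{n-1}Y_k$$ be the Clifford–Legendre polynomial ($C_{0,m}^0(Y_k)=Y_k$). Then the restriction of $C_{n,m}^0(Y_k)$ to $B(1)$ is square integrable, and $$\int_{B(1)}|C_{n,m}^0(Y_k)(x)|^2\,dx=\frac{2^{2n}(n!)^2}{2k+2n+m}.$$ -/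

import Mathlib

open MeasureTheory

noncomputable section

namespace CliffordLegendre

/-- Euclidean space `ℝ^m`. -/
abbrev Euc (m : ℕ) : Type := EuclideanSpace ℝ (Fin m)

/-- The quadratic form `x ↦ -|x|²` on `ℝ^m`. -/
def negNormSq (m : ℕ) : QuadraticForm ℝ (Euc m) :=
  -LinearMap.BilinMap.toQuadraticMap (innerₗ (Euc m))

theorem negNormSq_apply {m : ℕ} (x : Euc m) : negNormSq m x = -‖x‖ ^ 2 := by
  simp [negNormSq]

/-- The real Clifford algebra `ℝ_m`, generated by `e_1, …, e_m` with `e_j² = -1` and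
`e_i e_j = -e_j e_i` for `i ≠ j`. -/
abbrev Cl (m : ℕ) : Type := CliffordAlgebra (negNormSq m)

/-- The standard orthonormal basis vector `e_j` of `ℝ^m`. -/
def stdVec {m : ℕ} (j : Fin m) : Euc m := EuclideanSpace.single j (1 : ℝ)

/-- The generator `e_j` of the Clifford algebra. -/
def e {m : ℕ} (j : Fin m) : Cl m := CliffordAlgebra.ι (negNormSq m) (stdVec j)

/-- The basis element `e_A = e_{j_1} ⋯ e_{j_h}`, for `A = {j_1 < ⋯ < j_h}`. -/
def blade {m : ℕ} (A : Finset (Fin m)) : Cl m := (A.sort.map e).prod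

/-- The scalar part `[λ]_0` of a Clifford number, i.e. its component of degree `0` under the
identification of the Clifford algebra with the exterior algebra. -/
def scalarPart (m : ℕ) : Cl m →ₗ[ℝ] ℝ :=
  (ExteriorAlgebra.algebraMapInv (R := ℝ) (M := Euc m)).toLinearMap ∘ₗ
    (CliffordAlgebra.equivExterior (negNormSq m)).toLinearMap

theorem e_mul_self {m : ℕ} (j : Fin m) : e j * e j = -1 := by
  rw [e, CliffordAlgebra.ι_sq_scalar, negNormSq_apply]
  simp [stdVec]

theorem isOrtho_stdVec {m : ℕ} {i j : Fin m} (h : i ≠ j) :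
    (negNormSq m).IsOrtho (stdVec i) (stdVec j) := by
  rw [QuadraticMap.isOrtho_def, negNormSq_apply, negNormSq_apply, negNormSq_apply,
    norm_add_sq_real]
  have : inner ℝ (stdVec i) (stdVec j) = 0 := by
    simp [stdVec, EuclideanSpace.inner_single_left, h]
  rw [this]; ring

theorem e_mul_e {m : ℕ} {i j : Fin m} (h : i ≠ j) : e i * e j = -(e j * e i) :=
  CliffordAlgebra.ι_mul_ι_comm_of_isOrtho (isOrtho_stdVec h)

theorem e_mul_list {m : ℕ} (j : Fin m) (l : List (Fin m)) (hl : l.Pairwise (· < ·)) :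
    ∃ l' : List (Fin m), l'.Pairwise (· < ·) ∧ (∀ i, i ∈ l' ↔ Xor (i ∈ l) (i = j)) ∧
      (e j * (l.map e).prod = (l'.map e).prod ∨ e j * (l.map e).prod = -(l'.map e).prod) := by
  induction l with
  | nil => exact ⟨[j], by simp, by simp [Xor], by simp⟩
  | cons a l ih =>
    rw [List.pairwise_cons] at hl
    rcases lt_trichotomy j a with h | h | h
    · refine ⟨j :: a :: l, ?_, ?_, by simp⟩
      · rw [List.pairwise_cons, List.pairwise_cons]
        refine ⟨?_, hl⟩
        intro b hb
        rcases List.mem_cons.1 hb with rfl | hb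
        · exact h
        · exact h.trans (hl.1 b hb)
      · intro i
        have : j ∉ l := fun hj => absurd (hl.1 j hj) (not_lt.2 h.le)
        simp only [List.mem_cons, Xor]
        by_cases hij : i = j
        · subst hij; simp [h.ne, this]
        · simp [hij]
    · subst h
      refine ⟨l, hl.2, ?_, Or.inr ?_⟩
      · intro i
        have : j ∉ l := fun hj => absurd (hl.1 j hj) (lt_irrefl _)
        simp only [List.mem_cons, Xor]
        by_cases hij : i = j
        · subst hij; simp [this]
        · simp [hij]
      · simp [← mul_assoc, e_mul_self]
    · obtain ⟨l', h1, h2, h3⟩ := ih hl.2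
      refine ⟨a :: l', ?_, ?_, ?_⟩
      · rw [List.pairwise_cons]
        refine ⟨fun b hb => ?_, h1⟩
        rcases (h2 b).1 hb with hb | hb
        · exact hl.1 b hb.1
        · exact hb.1 ▸ h
      · intro i
        simp only [List.mem_cons, h2, Xor]
        by_cases hia : i = a
        · subst hia; simp [h.ne]
        · simp [hia]
      · have key : e j * ((a :: l).map e).prod = -(e a * (e j * (l.map e).prod)) := by
          simp only [List.map_cons, List.prod_cons, ← mul_assoc]
          rw [e_mul_e h.ne', neg_mul]
        rw [key]
        rcases h3 with h3 | h3 <;> rw [h3] <;> simp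

theorem exists_blade_of_list {m : ℕ} (l : List (Fin m)) :
    ∃ A : Finset (Fin m), (∀ i, i ∈ A ↔ Odd (l.count i)) ∧
      ((l.map e).prod = blade A ∨ (l.map e).prod = -blade A) := by
  suffices H : ∃ l' : List (Fin m), l'.Pairwise (· < ·) ∧ (∀ i, i ∈ l' ↔ Odd (l.count i)) ∧
      ((l.map e).prod = (l'.map e).prod ∨ (l.map e).prod = -(l'.map e).prod) by
    obtain ⟨l', h1, h2, h3⟩ := H
    refine ⟨l'.toFinset, by simpa using h2, ?_⟩
    have : l'.toFinset.sort = l' :=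
      (List.toFinset_sort (r := (· ≤ ·)) (h1.imp (fun h => h.ne))).2 (h1.imp (fun h => h.le))
    rw [blade, this]; exact h3
  induction l with
  | nil => exact ⟨[], by simp, by simp, by simp⟩
  | cons j l ih =>
    obtain ⟨l', h1, h2, h3⟩ := ih
    obtain ⟨l'', g1, g2, g3⟩ := e_mul_list j l' h1
    refine ⟨l'', g1, ?_, ?_⟩
    · intro i
      rw [g2, h2, List.count_cons]
      by_cases hij : i = j
      · subst hij; simp [Xor, Nat.odd_add_one]
      · have : ¬ j = i := fun h => hij h.symm
        simp [Xor, hij, this]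
    · simp only [List.map_cons, List.prod_cons]
      rcases h3 with h3 | h3 <;> rw [h3] <;> rcases g3 with g3 | g3 <;> simp [g3]

theorem contractLeft_prod_eq_zero {m : ℕ} (d : Module.Dual ℝ (Euc m)) (l : List (Fin m))
    (h : ∀ i ∈ l, d (stdVec i) = 0) :
    CliffordAlgebra.contractLeft d
      ((l.map fun j => CliffordAlgebra.ι (0 : QuadraticForm ℝ (Euc m)) (stdVec j)).prod) = 0 := by
  induction l with
  | nil => simp
  | cons a l ih =>
    simp only [List.map_cons, List.prod_cons]
    rw [CliffordAlgebra.contractLeft_ι_mul, h a (by simp), ih (fun i hi => h i (by simp [hi]))]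
    simp

theorem equivExterior_list {m : ℕ} (l : List (Fin m)) (hl : l.Nodup) :
    CliffordAlgebra.equivExterior (negNormSq m) (l.map e).prod =
      (l.map fun j => CliffordAlgebra.ι (0 : QuadraticForm ℝ (Euc m)) (stdVec j)).prod := by
  simp only [CliffordAlgebra.equivExterior, CliffordAlgebra.changeFormEquiv_apply]
  induction l with
  | nil => simp
  | cons a l ih =>
    rw [List.nodup_cons] at hl
    simp only [List.map_cons, List.prod_cons]
    rw [e, CliffordAlgebra.changeForm_ι_mul, ih hl.2, contractLeft_prod_eq_zero, sub_zero]
    intro i hi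
    have hne : a ≠ i := fun h => hl.1 (h ▸ hi)
    have := isOrtho_stdVec hne
    rw [QuadraticMap.isOrtho_def] at this
    simp [QuadraticMap.associated_apply, this]

theorem scalarPart_blade {m : ℕ} (A : Finset (Fin m)) :
    scalarPart m (blade A) = if A = ∅ then 1 else 0 := by
  have h : scalarPart m (blade A) = ExteriorAlgebra.algebraMapInv
      ((CliffordAlgebra.equivExterior (negNormSq m)) (A.sort.map e).prod) := rfl
  rw [h, equivExterior_list _ (A.sort_nodup _)]
  split_ifs with hA
  · subst hA; simp
  · obtain ⟨a, l, hal⟩ : ∃ a l, A.sort (· ≤ ·) = a :: l := by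
      cases hs : A.sort (· ≤ ·) with
      | nil =>
        refine absurd (Finset.card_eq_zero.1 ?_) hA
        rw [← Finset.length_sort (s := A) (· ≤ ·), hs]; rfl
      | cons a l => exact ⟨a, l, rfl⟩
    rw [hal, List.map_cons, List.prod_cons, map_mul]
    have : ExteriorAlgebra.algebraMapInv
        (CliffordAlgebra.ι (0 : QuadraticForm ℝ (Euc m)) (stdVec a)) = 0 :=
      (ExteriorAlgebra.lift_ι_apply ℝ (0 : Euc m →ₗ[ℝ] ℝ) _ (stdVec a))
    rw [this, zero_mul]

theorem star_list {m : ℕ} (l : List (Fin m)) :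
    star (l.map e).prod = (l.reverse.map e).prod ∨
      star (l.map e).prod = -(l.reverse.map e).prod := by
  induction l with
  | nil => simp
  | cons a l ih =>
    have ha : star (e a) = -e a := CliffordAlgebra.star_ι _
    simp only [List.map_cons, List.prod_cons, star_mul, ha, List.reverse_cons, List.map_append,
      List.prod_append, List.map_nil, List.prod_nil, mul_one, mul_neg]
    rcases ih with ih | ih <;> rw [ih] <;> simp

theorem star_list_mul_self {m : ℕ} (l : List (Fin m)) :
    star (l.map e).prod * (l.map e).prod = 1 := by
  induction l with
  | nil => simp
  | cons a l ih =>
    have ha : star (e a) = -e a := CliffordAlgebra.star_ι _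
    simp only [List.map_cons, List.prod_cons, star_mul, ha]
    calc _ = -(star (l.map e).prod * (e a * e a) * (l.map e).prod) := by noncomm_ring
      _ = 1 := by rw [e_mul_self]; simp [ih]

/-- The real inner product `(λ, μ) = [λ̄ μ]_0` on the Clifford algebra, where `λ̄` (`star λ`) is the
anti-automorphism with `ē_j = -e_j`. -/
def cliffordInner {m : ℕ} (x y : Cl m) : ℝ := scalarPart m (star x * y)

theorem cliffordInner_blade {m : ℕ} (A B : Finset (Fin m)) :
    cliffordInner (blade A) (blade B) = if A = B then 1 else 0 := by
  have h1 : scalarPart m 1 = 1 := by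
    have := scalarPart_blade (m := m) ∅
    simpa [blade] using this
  split_ifs with hAB
  · subst hAB
    rw [cliffordInner, blade, star_list_mul_self, h1]
  · have hz : scalarPart m ((A.sort.reverse ++ B.sort).map e).prod = 0 := by
      obtain ⟨C, hC, h⟩ := exists_blade_of_list (A.sort.reverse ++ B.sort)
      have hC0 : C ≠ ∅ := by
        rintro rfl
        apply hAB
        ext i
        have := hC i
        rw [List.count_append, List.count_reverse,
          (A.sort_nodup (· ≤ ·)).count, (B.sort_nodup (· ≤ ·)).count] at this
        by_cases hA : i ∈ A <;> by_cases hB : i ∈ B <;> simp_all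
      rcases h with h | h <;> rw [h] <;> simp [scalarPart_blade, hC0]
    rw [List.map_append, List.prod_append] at hz
    rw [cliffordInner, blade, blade]
    rcases star_list A.sort with h | h <;> rw [h]
    · exact hz
    · rw [neg_mul, map_neg, hz, neg_zero]

theorem span_blade (m : ℕ) : Submodule.span ℝ (Set.range (blade (m := m))) = ⊤ := by
  rw [eq_top_iff]
  have hlist : ∀ l : List (Fin m),
      (l.map e).prod ∈ Submodule.span ℝ (Set.range (blade (m := m))) := by
    intro l
    obtain ⟨A, -, h⟩ := exists_blade_of_list l
    have hA : blade A ∈ Submodule.span ℝ (Set.range (blade (m := m))) :=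
      Submodule.subset_span ⟨A, rfl⟩
    rcases h with h | h <;> rw [h]
    · exact hA
    · exact neg_mem hA
  have hmul : ∀ (j : Fin m) (x : Cl m), x ∈ Submodule.span ℝ (Set.range (blade (m := m))) →
      e j * x ∈ Submodule.span ℝ (Set.range (blade (m := m))) := by
    intro j x hx
    induction hx using Submodule.span_induction with
    | mem x hx => obtain ⟨A, rfl⟩ := hx; exact hlist (j :: A.sort)
    | zero => simp
    | add x y _ _ hx hy => rw [mul_add]; exact add_mem hx hy
    | smul c x _ hx => rw [mul_smul_comm]; exact Submodule.smul_mem _ _ hx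
  intro x _
  induction x using CliffordAlgebra.left_induction with
  | algebraMap r =>
    rw [Algebra.algebraMap_eq_smul_one]
    exact Submodule.smul_mem _ _ (hlist [])
  | add x y hx hy => exact add_mem (hx trivial) (hy trivial)
  | ι_mul x v hx =>
    have hv : v = ∑ j, v j • stdVec j := by
      ext i; simp [stdVec, Finset.sum_apply, Pi.single_apply]
    rw [hv, map_sum, Finset.sum_mul]
    refine Submodule.sum_mem _ fun j _ => ?_
    rw [map_smul, smul_mul_assoc]
    exact Submodule.smul_mem _ _ (hmul j x (hx trivial))

theorem exists_coeff {m : ℕ} (x : Cl m) : ∃ c : Finset (Fin m) → ℝ, x = ∑ A, c A • blade A := by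
  have hx : x ∈ Submodule.span ℝ (Set.range (blade (m := m))) := by rw [span_blade]; trivial
  obtain ⟨c, hc⟩ := (Submodule.mem_span_range_iff_exists_fun ℝ).1 hx
  exact ⟨c, hc.symm⟩

theorem cliffordInner_sum {m : ℕ} (c d : Finset (Fin m) → ℝ) :
    cliffordInner (∑ A, c A • blade A) (∑ A, d A • blade A) = ∑ A, c A * d A := by
  have h : ∀ A B : Finset (Fin m), scalarPart m (star (blade A) * blade B) =
      if A = B then 1 else 0 := cliffordInner_blade
  simp [cliffordInner, star_sum, Finset.sum_mul, Finset.mul_sum, CliffordAlgebra.star_smul, h, mul_comm]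

/-- The inner product `(λ, μ) = [λ̄ μ]_0` is positive definite. -/
@[reducible]
def innerCore (m : ℕ) : InnerProductSpace.Core ℝ (Cl m) where
  inner := cliffordInner
  conj_inner_symm x y := by
    obtain ⟨c, rfl⟩ := exists_coeff x
    obtain ⟨d, rfl⟩ := exists_coeff y
    simp only [cliffordInner_sum, conj_trivial]
    exact Finset.sum_congr rfl fun _ _ => mul_comm _ _
  re_inner_nonneg x := by
    obtain ⟨c, rfl⟩ := exists_coeff x
    simp only [cliffordInner_sum, RCLike.re_to_real]
    exact Finset.sum_nonneg fun _ _ => mul_self_nonneg _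
  add_left x y z := by simp [cliffordInner, add_mul]
  smul_left x y r := by simp [cliffordInner, CliffordAlgebra.star_smul]
  definite x h := by
    obtain ⟨c, rfl⟩ := exists_coeff x
    simp only [cliffordInner_sum] at h
    have := (Finset.sum_eq_zero_iff_of_nonneg fun A _ => mul_self_nonneg (c A)).1 h
    exact Finset.sum_eq_zero fun A hA => by simp [mul_self_eq_zero.1 (this A hA)]

/-- The norm on the Clifford algebra is `|λ|² = [λ̄ λ]_0 = ∑_A |λ_A|²`. -/
instance instNormedAddCommGroupCl (m : ℕ) : NormedAddCommGroup (Cl m) :=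
  (innerCore m).toNormedAddCommGroup

instance instInnerProductSpaceCl (m : ℕ) : InnerProductSpace ℝ (Cl m) :=
  InnerProductSpace.ofCore (innerCore m).toCore

/-- `|λ|² = [λ̄ λ]_0`. -/
theorem norm_sq_eq_scalarPart {m : ℕ} (x : Cl m) : ‖x‖ ^ 2 = scalarPart m (star x * x) :=
  (real_inner_self_eq_norm_sq x).symm

/-- `|∑_A λ_A e_A|² = ∑_A λ_A²`. -/
theorem norm_sq_sum_blade {m : ℕ} (c : Finset (Fin m) → ℝ) :
    ‖∑ A, c A • blade A‖ ^ 2 = ∑ A, c A ^ 2 := by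
  rw [← real_inner_self_eq_norm_sq]
  exact (cliffordInner_sum c c).trans (Finset.sum_congr rfl fun _ _ => (sq _).symm)

/-- The Dirac operator `∂_x f = ∑_j e_j ∂f/∂x_j`. -/
def dirac {m : ℕ} (f : Euc m → Cl m) (x : Euc m) : Cl m :=
  ∑ j : Fin m, e j * lineDeriv ℝ f x (stdVec j)

/-- `f(x) = ∑_A p_A(x) e_A`, where every `p_A` is a real homogeneous polynomial of degree `k`. -/
def IsHomogeneousPolynomial {m : ℕ} (k : ℕ) (f : Euc m → Cl m) : Prop :=
  ∃ p : Finset (Fin m) → MvPolynomial (Fin m) ℝ, (∀ A, (p A).IsHomogeneous k) ∧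
    ∀ x : Euc m, f x = ∑ A, MvPolynomial.eval (fun j => x j) (p A) • blade A

/-- Left solid inner spherical monogenics of order `k`: left monogenic (`∂_x Y = 0`)
Clifford-algebra-valued homogeneous polynomials of degree `k` on `ℝ^m`. -/
structure IsSphericalMonogenic {m : ℕ} (k : ℕ) (Y : Euc m → Cl m) : Prop where
  homogeneous : IsHomogeneousPolynomial k Y
  monogenic : ∀ x, dirac Y x = 0

/-- The operator `D_α f(x) = (1 + x²)^{-α} ∂_x ((1 + x²)^{α+1} f(x))`, where `x² = -|x|²` is the
Clifford square of the vector `x`. It acts on functions on the unit ball; only the values at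
points with `|x| < 1` are meaningful, and these depend only on `f` on the open unit ball. -/
def gegenbauerOp {m : ℕ} (α : ℝ) (f : Euc m → Cl m) (x : Euc m) : Cl m :=
  (1 - ‖x‖ ^ 2) ^ (-α) • dirac (fun y => (1 - ‖y‖ ^ 2) ^ (α + 1) • f y) x

/-- The Clifford-Gegenbauer polynomial `C_{n,m}^α(Y) = D_α D_{α+1} ⋯ D_{α+n-1} Y`, on the unit
ball. -/
def cliffordGegenbauer {m : ℕ} : ℕ → ℝ → (Euc m → Cl m) → Euc m → Cl m
  | 0, _, Y => Y
  | n + 1, α, Y => gegenbauerOp α (cliffordGegenbauer n (α + 1) Y)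

/-- The Clifford-Legendre polynomial `C_{n,m}^0(Y)`. -/
def cliffordLegendre {m : ℕ} (n : ℕ) (Y : Euc m → Cl m) : Euc m → Cl m :=
  cliffordGegenbauer n 0 Y

/-- `L²`-normalisation on the unit sphere with its (unnormalised) surface measure:
`∫_{S^{m-1}} |Y(θ)|² dθ = 1`. -/
def IsNormalizedOnSphere {m : ℕ} (Y : Euc m → Cl m) : Prop :=
  ∫ θ : Metric.sphere (0 : Euc m) 1, ‖Y θ‖ ^ 2 ∂(volume : Measure (Euc m)).toSphere = 1

instance instFiniteDimensionalCl (m : ℕ) : FiniteDimensional ℝ (Cl m) :=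
  Module.Finite.of_surjective (Fintype.linearCombination ℝ (blade (m := m)))
    (fun x => by
      obtain ⟨c, rfl⟩ := exists_coeff x
      exact ⟨c, by simp [Fintype.linearCombination_apply]⟩)

/-- Every member of a family that is orthonormal for the Clifford-algebra-valued inner product
`∫_{S^{m-1}} \overline{Y(θ)} Y'(θ) dθ` is normalised in the above sense. -/
theorem isNormalizedOnSphere_of_orthonormal {m : ℕ} {I : Type*} [DecidableEq I]
    (Y : I → Euc m → Cl m)
    (h : ∀ i j, ∫ θ : Metric.sphere (0 : Euc m) 1, star (Y i θ) * Y j θ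
      ∂(volume : Measure (Euc m)).toSphere = if i = j then 1 else 0) (i : I) :
    IsNormalizedOnSphere (Y i) := by
  have hi := h i i
  rw [if_pos rfl] at hi
  have h1 : scalarPart m 1 = 1 := by simpa [blade] using scalarPart_blade (m := m) ∅
  have hne : (1 : Cl m) ≠ 0 := fun h0 => by rw [h0, map_zero] at h1; exact zero_ne_one h1
  have hint := not_imp_comm.1 integral_undef (hi ▸ hne)
  have := (LinearMap.toContinuousLinearMap (scalarPart m)).integral_comp_comm hint
  rw [hi] at this
  simpa [IsNormalizedOnSphere, norm_sq_eq_scalarPart, h1] using this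

end CliffordLegendre

end

open CliffordLegendre

/-! Everything takes place among functions `p(x) Y(x)`, with `p` a real polynomial in the vector
variable `x`. With `μ = 2k + m`, the Dirac operator acts on them as the linear map `T : X^s ↦ -a_s
X^(s-1)` (`polyDirac`). Cancelling the weights gives a Rodrigues formula: on the open ball the
Clifford-Legendre polynomial is `p(x) Y(x)` with `p = T^n (1 + X²)^n`. Left multiplication by `x` is
skew-adjoint with square `-|x|²`, so `|p(x) Y|² = (Y, p(-x) p(x) Y)` and `x^u` contributes `Re(i^u)
|x|^u |Y|²`. Polar coordinates and the normalization of `Y` turn the integral into `L(p(-X) p)`,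
where `L(X^u) = Re(i^u) / (u + μ)` (`ballMoment`). The one-variable problem is solved as for
classical Legendre polynomials. Integration by parts (`ballMoment_polyDirac_sub`) has a boundary
term at `X = i`, killed by a factor `1 + X²`; hence all `n` copies of `T` move to the other side.
There `T^(2n) (1 + X²)^n` is the constant `∏ (-a_s)`, `1 ≤ s ≤ 2n`. What remains is the beta-type
integral `L((1 + X²)^n)`, found by recursion, and the product telescopes (`ballMoment_legendre`). -/

noncomputable section

namespace CliffordLegendre

/-! ### The Dirac operator on polynomials in the vector variable. -/

open Polynomial

/-- The coefficient `a_s` in `∂(x^s Y) = -a_s x^(s-1) Y`, where `Y` is a spherical monogenic of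
order `k` on `ℝ^m` and `μ = 2k + m`: it is `s` for even `s` and `s + μ - 1` for odd `s`. -/
def diracCoeff (μ : ℝ) (s : ℕ) : ℝ := if Even s then s else s + μ - 1

/-- This makes the truncated exponent `s - 1` harmless at `s = 0` throughout. -/
theorem diracCoeff_zero (μ : ℝ) : diracCoeff μ 0 = 0 := by simp [diracCoeff]

/-- The recursion forced by `∂(x f) = -m f - 2 E f - x ∂f`, with `E` the Euler operator, for `f =
x^s Y` of degree `s + k`. -/
theorem diracCoeff_succ_add (μ : ℝ) (s : ℕ) :
    diracCoeff μ (s + 1) + diracCoeff μ s = 2 * s + μ := by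
  by_cases h : Even s <;> simp [diracCoeff, h, Nat.even_add_one] <;> ring

theorem diracCoeff_add_two (μ : ℝ) (s : ℕ) : diracCoeff μ (s + 2) = diracCoeff μ s + 2 := by
  by_cases h : Even s
  · simp [diracCoeff, h, Nat.even_add]
  · simp [diracCoeff, h, Nat.even_add]
    ring

/-- The action `p ↦ T p` of the Dirac operator on functions `p(x) Y(x)`, where `p` is a polynomial
in the vector variable `x`: `∂(p(x) Y(x)) = (T p)(x) Y(x)`. -/
def polyDirac (μ : ℝ) : ℝ[X] →ₗ[ℝ] ℝ[X] :=
  lsum fun s => (-diracCoeff μ s) • monomial (s - 1)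

theorem polyDirac_monomial (μ : ℝ) (s : ℕ) (c : ℝ) :
    polyDirac μ (monomial s c) = monomial (s - 1) (-diracCoeff μ s * c) := by
  simp [polyDirac, lsum_apply, sum_monomial_index, smul_monomial]

/-- Leibniz rule for the scalar factor `1 + x² = 1 - |x|²`, whose gradient is `-2x`. -/
theorem polyDirac_one_add_sq_mul (μ : ℝ) (p : ℝ[X]) :
    polyDirac μ ((1 + X ^ 2) * p) = (1 + X ^ 2) * polyDirac μ p - 2 * X * p := by
  induction p using Polynomial.induction_on' with
  | add p q hp hq => rw [mul_add, map_add, map_add, hp, hq]; ring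
  | monomial s c =>
    have h : (1 + X ^ 2 : ℝ[X]) * monomial s c = monomial s c + monomial (s + 2) c := by
      rw [add_mul, one_mul, X_pow_mul_monomial]
    rw [h, map_add]
    simp only [polyDirac_monomial, diracCoeff_add_two]
    simp only [← C_mul_X_pow_eq_monomial, map_mul, map_neg, map_add]
    rcases s with _ | s
    · simp [diracCoeff_zero, C_ofNat]
      ring
    · simp only [Nat.add_sub_cancel, show s + 1 + 2 - 1 = s + 2 from rfl, C_ofNat]
      ring

theorem dvd_polyDirac {μ : ℝ} {p : ℝ[X]} {j : ℕ} (h : (1 + X ^ 2) ^ (j + 1) ∣ p) :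
    (1 + X ^ 2) ^ j ∣ polyDirac μ p := by
  induction j generalizing p with
  | zero => simp
  | succ j ih =>
    obtain ⟨q, rfl⟩ := h
    rw [pow_succ' _ (j + 1), mul_assoc, polyDirac_one_add_sq_mul]
    refine dvd_sub ?_ ?_
    · rw [pow_succ' _ j]
      refine mul_dvd_mul_left _ (ih ?_)
      rw [← pow_succ']
      exact dvd_mul_right _ _
    · exact Dvd.dvd.mul_left (dvd_mul_right _ _) _

theorem polyDirac_mem_degreeLT {μ : ℝ} {p : ℝ[X]} {n : ℕ} (h : p ∈ degreeLT ℝ (n + 1)) :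
    polyDirac μ p ∈ degreeLT ℝ n := by
  rw [mem_degreeLT, degree_lt_iff_coeff_zero] at h
  rw [p.as_sum_support, map_sum]
  refine Submodule.sum_mem _ fun s hs => ?_
  rw [polyDirac_monomial, mem_degreeLT]
  have hs' : s < n + 1 := by
    by_contra hc
    exact mem_support_iff.1 hs (h s (not_lt.1 hc))
  rcases s with _ | s
  · simp [diracCoeff_zero]
  · exact (degree_monomial_le _ _).trans_lt (by exact_mod_cast (by omega : s < n))

theorem polyDirac_iterate_eq_zero {μ : ℝ} {p : ℝ[X]} {n : ℕ} (h : p ∈ degreeLT ℝ n) :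
    (polyDirac μ)^[n] p = 0 := by
  induction n generalizing p with
  | zero => simpa [mem_degreeLT, Nat.WithBot.lt_zero_iff] using h
  | succ n ih => exact ih (polyDirac_mem_degreeLT h)

theorem polyDirac_iterate_X_pow (μ : ℝ) (n : ℕ) :
    (polyDirac μ)^[n] (X ^ n) = C (∏ s ∈ Finset.range n, -diracCoeff μ (s + 1)) := by
  induction n with
  | zero => simp
  | succ n ih =>
    have h : polyDirac μ (X ^ (n + 1)) = (-diracCoeff μ (n + 1)) • X ^ n := by
      rw [X_pow_eq_monomial, polyDirac_monomial, X_pow_eq_monomial, smul_monomial]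
      simp
    have hs : ∀ (i : ℕ) (c : ℝ) (p : ℝ[X]),
        (polyDirac μ)^[i] (c • p) = c • (polyDirac μ)^[i] p := by
      intro i c p
      rw [← Module.End.coe_pow, map_smul]
    rw [Function.iterate_succ_apply, h, hs, ih, Finset.prod_range_succ, smul_C, smul_eq_mul,
      mul_comm]

/-- `T` lowers degrees, so `2n` applications annihilate everything below the leading term `X^(2n)`.
-/
theorem polyDirac_iterate_one_add_sq_pow (μ : ℝ) (n : ℕ) :
    (polyDirac μ)^[2 * n] ((1 + X ^ 2) ^ n) =
      C (∏ s ∈ Finset.range (2 * n), -diracCoeff μ (s + 1)) := by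
  have hd : (1 + X ^ 2 : ℝ[X]) ^ n - X ^ (2 * n) ∈ degreeLT ℝ (2 * n) := by
    have hm : (1 + X ^ 2 : ℝ[X]).Monic := by monicity!
    have hm2 := hm.pow n
    have hdeg : (1 + X ^ 2 : ℝ[X]).natDegree = 2 := by compute_degree!
    have hd1 : ((1 + X ^ 2 : ℝ[X]) ^ n).degree = (2 * n : ℕ) := by
      rw [degree_eq_natDegree hm2.ne_zero, hm.natDegree_pow, hdeg, mul_comm]
    rw [mem_degreeLT, ← hd1]
    refine degree_sub_lt_left ?_ hm2.ne_zero ?_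
    · rw [hd1, degree_X_pow]
    · rw [hm2.leadingCoeff, leadingCoeff_X_pow]
  have h := polyDirac_iterate_eq_zero (μ := μ) hd
  rw [← Module.End.coe_pow, map_sub, sub_eq_zero] at h
  rw [← polyDirac_iterate_X_pow, ← Module.End.coe_pow, h]

/-! ### Radial moments and integration by parts. -/

/-- The linear functional `X^u ↦ Re(i^u) / (u + μ)`, that is `p ↦ ∫₀¹ Re p(ir) r^(μ-1) dr`. -/
def ballMoment (μ : ℝ) : ℝ[X] →ₗ[ℝ] ℝ :=
  lsum fun u => ((Complex.I ^ u).re / (u + μ)) • LinearMap.id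

theorem ballMoment_monomial (μ : ℝ) (u : ℕ) (c : ℝ) :
    ballMoment μ (monomial u c) = (Complex.I ^ u).re / (u + μ) * c := by
  simp [ballMoment, lsum_apply, sum_monomial_index]

theorem I_pow_re_of_odd {u : ℕ} (h : Odd u) : (Complex.I ^ u).re = 0 := by
  obtain ⟨v, rfl⟩ := h
  rw [pow_succ, pow_mul, Complex.I_sq]
  rcases neg_one_pow_eq_or ℂ v with h | h <;> simp [h]

theorem I_pow_succ_im (u : ℕ) : (Complex.I ^ (u + 1)).im = (Complex.I ^ u).re := by
  simp [pow_succ]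

theorem monomial_comp_neg_X (s : ℕ) (c : ℝ) :
    (monomial s c).comp (-X) = monomial s ((-1) ^ s * c) := by
  rw [monomial_comp, neg_pow, ← C_mul_X_pow_eq_monomial, map_mul]
  simp
  ring

/-- Radial form of Stokes' theorem. For `X^s`, `X^t` with `s + t = u + 1`, the left side carries
`(a_s + a_t) Re(i^u) / (u + μ)`. If `u` is odd this vanishes; if `u` is even, `s` and `t` have
opposite parity, so `a_s + a_t = u + μ` cancels the denominator. -/
theorem ballMoment_polyDirac_sub {μ : ℝ} (hμ : 0 < μ) (p q : ℝ[X]) :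
    ballMoment μ ((polyDirac μ p).comp (-X) * q) - ballMoment μ (p.comp (-X) * polyDirac μ q) =
      (aeval Complex.I (p.comp (-X) * q)).im := by
  induction p using Polynomial.induction_on' with
  | add p p' hp hp' =>
    simp only [map_add, add_comp, add_mul, Complex.add_im]
    rw [← hp, ← hp']; ring
  | monomial s c =>
    induction q using Polynomial.induction_on' with
    | add q q' hq hq' =>
      simp only [map_add, mul_add, Complex.add_im]
      rw [← hq, ← hq']; ring
    | monomial t d =>
      simp only [polyDirac_monomial, monomial_comp_neg_X, monomial_mul_monomial,
        ballMoment_monomial, aeval_monomial, Complex.coe_algebraMap, Complex.im_ofReal_mul]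
      obtain hst | ⟨u, hu⟩ : s + t = 0 ∨ ∃ u, s + t = u + 1 := by
        rcases h : s + t with _ | u
        · exact Or.inl rfl
        · exact Or.inr ⟨u, rfl⟩
      · obtain ⟨rfl, rfl⟩ : s = 0 ∧ t = 0 := by omega
        simp [diracCoeff_zero]
      have hs : (Complex.I ^ (s - 1 + t)).re / (((s - 1 + t : ℕ) : ℝ) + μ) *
          ((-1) ^ (s - 1) * (-diracCoeff μ s * c) * d) =
          (Complex.I ^ u).re / (u + μ) * ((-1) ^ s * diracCoeff μ s * c * d) := by
        rcases s with _ | s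
        · simp [diracCoeff_zero]
        · rw [show s + 1 - 1 + t = u by omega, Nat.add_sub_cancel, pow_succ]
          ring
      have ht : (Complex.I ^ (s + (t - 1))).re / (((s + (t - 1) : ℕ) : ℝ) + μ) *
          ((-1) ^ s * c * (-diracCoeff μ t * d)) =
          (Complex.I ^ u).re / (u + μ) * (-(-1) ^ s * diracCoeff μ t * c * d) := by
        rcases t with _ | t
        · simp [diracCoeff_zero]
        · rw [show s + (t + 1 - 1) = u by omega]
          ring
      rw [hs, ht, hu, I_pow_succ_im]
      rcases Nat.even_or_odd u with he | ho
      · have hsum : diracCoeff μ s + diracCoeff μ t = u + μ := by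
          have hcast : (s : ℝ) + t = u + 1 := by exact_mod_cast hu
          have hpar : ¬ Even (s + t) := by rw [hu, Nat.even_add_one]; simpa using he
          rw [Nat.even_add] at hpar
          by_cases h : Even s
          · have h' : ¬ Even t := by tauto
            simp only [diracCoeff, h, h', if_true, if_false]; linarith
          · have h' : Even t := by tauto
            simp only [diracCoeff, h, h', if_true, if_false]; linarith
        have hne : (u : ℝ) + μ ≠ 0 := by positivity
        rw [div_mul_eq_mul_div, div_mul_eq_mul_div, ← sub_div, div_eq_iff hne, ← hsum]
        ring
      · rw [I_pow_re_of_odd ho]; simp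

/-- The boundary term vanishes because `i` is a root of `1 + X²`, which is even and so unaffected by
`X ↦ -X`. -/
theorem ballMoment_polyDirac {μ : ℝ} (hμ : 0 < μ) {p : ℝ[X]} (hp : 1 + X ^ 2 ∣ p) (q : ℝ[X]) :
    ballMoment μ ((polyDirac μ p).comp (-X) * q) = ballMoment μ (p.comp (-X) * polyDirac μ q) := by
  rw [← sub_eq_zero, ballMoment_polyDirac_sub hμ]
  obtain ⟨p, rfl⟩ := hp
  simp

/-- Each application of `T` costs one factor `1 + X²`, so `n` factors allow `n` integrations by
parts. -/
theorem ballMoment_polyDirac_iterate {μ : ℝ} (hμ : 0 < μ) {p : ℝ[X]} {n : ℕ}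
    (hp : (1 + X ^ 2) ^ n ∣ p) (q : ℝ[X]) :
    ballMoment μ (((polyDirac μ)^[n] p).comp (-X) * q) =
      ballMoment μ (p.comp (-X) * (polyDirac μ)^[n] q) := by
  induction n generalizing p with
  | zero => rfl
  | succ n ih =>
    rw [Function.iterate_succ_apply, ih (dvd_polyDirac hp),
      ballMoment_polyDirac hμ ((dvd_pow_self _ n.succ_ne_zero).trans hp),
      Function.iterate_succ_apply']

theorem ballMoment_one_add_sq_pow_succ {μ : ℝ} (hμ : 0 < μ) (n : ℕ) :
    (μ + 2 * n + 2) * ballMoment μ ((1 + X ^ 2) ^ (n + 1)) =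
      2 * (n + 1) * ballMoment μ ((1 + X ^ 2) ^ n) := by
  -- Leibniz rule with `T X = -μ` and `X² = (1 + X²) - 1`. For `n = 0` the truncated exponent has
  -- coefficient zero.
  have hT : ∀ n : ℕ, polyDirac μ ((1 + X ^ 2) ^ n * X) =
      C (-(μ + 2 * n)) * (1 + X ^ 2) ^ n + C (2 * (n : ℝ)) * (1 + X ^ 2) ^ (n - 1) := by
    intro n
    induction n with
    | zero =>
      have := polyDirac_monomial μ 1 1
      simp [monomial_one_one_eq_X] at this
      simp [this, diracCoeff]
    | succ n ih =>
      rw [pow_succ', mul_assoc, polyDirac_one_add_sq_mul, ih]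
      rcases n with _ | n
      · simp [C_ofNat]; ring
      · simp [C_ofNat]; ring
  -- Testing against `q = 1`, with `T 1 = 0`, makes the moment of `T p` vanish; that is the
  -- recursion.
  have h := ballMoment_polyDirac hμ (p := (1 + X ^ 2) ^ (n + 1) * X)
    (Dvd.dvd.mul_right (dvd_pow_self _ n.succ_ne_zero) _) 1
  have h1 : polyDirac μ 1 = 0 := by
    have := polyDirac_monomial μ 0 1
    simpa [diracCoeff_zero] using this
  rw [h1, hT, mul_zero, map_zero, mul_one, Nat.add_sub_cancel, ← smul_eq_C_mul, ← smul_eq_C_mul]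
    at h
  simp only [add_comp, smul_comp, pow_comp, one_comp, X_comp, neg_sq, map_add, map_smul,
    smul_eq_mul] at h
  push_cast at h
  linarith

theorem ballMoment_one_add_sq_pow {μ : ℝ} (hμ : 0 < μ) (n : ℕ) :
    ballMoment μ ((1 + X ^ 2) ^ n) * ∏ s ∈ Finset.range (2 * n), -diracCoeff μ (s + 1) =
      2 ^ (2 * n) * (n.factorial : ℝ) ^ 2 / (μ + 2 * n) := by
  induction n with
  | zero =>
    have := ballMoment_monomial μ 0 1
    simp at this
    simp [this]
  | succ n ih =>
    have h := ballMoment_one_add_sq_pow_succ hμ n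
    have h1 : 0 < μ + 2 * n := by positivity
    have h2 : 0 < μ + 2 * n + 2 := by positivity
    have e1 : diracCoeff μ (2 * n + 1) = μ + 2 * n := by
      simp [diracCoeff]; ring
    have e2 : diracCoeff μ (2 * n + 1 + 1) = 2 * n + 2 := by
      simp [diracCoeff, Nat.even_add]; ring
    rw [mul_add, mul_one, Finset.prod_range_succ, Finset.prod_range_succ, e1, e2,
      Nat.factorial_succ]
    rw [eq_div_iff h1.ne'] at ih
    rw [eq_div_iff (by positivity)]
    push_cast
    linear_combination (∏ s ∈ Finset.range (2 * n), -diracCoeff μ (s + 1)) * (μ + 2 * n) *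
      (2 * n + 2) * h + 4 * (n + 1) ^ 2 * ih

theorem ballMoment_legendre {μ : ℝ} (hμ : 0 < μ) (n : ℕ) :
    ballMoment μ (((polyDirac μ)^[n] ((1 + X ^ 2) ^ n)).comp (-X) *
      (polyDirac μ)^[n] ((1 + X ^ 2) ^ n)) =
      2 ^ (2 * n) * (n.factorial : ℝ) ^ 2 / (μ + 2 * n) := by
  rw [ballMoment_polyDirac_iterate hμ dvd_rfl, ← Function.iterate_add_apply, ← two_mul,
    polyDirac_iterate_one_add_sq_pow, ← ballMoment_one_add_sq_pow hμ, mul_comm _ (C _),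
    ← smul_eq_C_mul, map_smul, smul_eq_mul, mul_comm]
  simp

/-! ### Dirac calculus for Clifford-valued functions. -/

/-- The inclusion of `ℝ^m` into the Clifford algebra. -/
abbrev vec {m : ℕ} (x : Euc m) : Cl m := CliffordAlgebra.ι (negNormSq m) x

theorem vec_mul_self {m : ℕ} (x : Euc m) : vec x * vec x = algebraMap ℝ (Cl m) (-‖x‖ ^ 2) := by
  rw [vec, CliffordAlgebra.ι_sq_scalar, negNormSq_apply]

theorem e_mul_vec {m : ℕ} (j : Fin m) (x : Euc m) :
    e j * vec x = algebraMap ℝ (Cl m) (-(2 * x j)) - vec x * e j := by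
  rw [eq_sub_iff_add_eq, e, vec, CliffordAlgebra.ι_mul_ι_add_swap]
  congr 1
  rw [QuadraticMap.polar, negNormSq_apply, negNormSq_apply, negNormSq_apply, norm_add_sq_real]
  simp [stdVec, EuclideanSpace.inner_single_left]
  ring

/-- Multiplication in the Clifford algebra as a continuous bilinear map. -/
def mulCLM (m : ℕ) : Cl m →L[ℝ] Cl m →L[ℝ] Cl m :=
  (LinearMap.mul ℝ (Cl m)).toContinuousBilinearMap

/-- The inclusion of `ℝ^m` into the Clifford algebra as a continuous linear map. -/
def vecCLM (m : ℕ) : Euc m →L[ℝ] Cl m :=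
  LinearMap.toContinuousLinearMap (CliffordAlgebra.ι (negNormSq m))

theorem hasFDerivAt_vec_mul {m : ℕ} {f : Euc m → Cl m} {x : Euc m} (hf : DifferentiableAt ℝ f x) :
    HasFDerivAt (fun y => vec y * f y)
      ((mulCLM m).precompR (Euc m) (vec x) (fderiv ℝ f x) +
        (mulCLM m).precompL (Euc m) (vecCLM m) (f x)) x :=
  (mulCLM m).hasFDerivAt_of_bilinear (vecCLM m).hasFDerivAt hf.hasFDerivAt

theorem dirac_eq_fderiv {m : ℕ} {f : Euc m → Cl m} {x : Euc m} (hf : DifferentiableAt ℝ f x) :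
    dirac f x = ∑ j, e j * fderiv ℝ f x (stdVec j) := by
  simp only [dirac, hf.lineDeriv_eq_fderiv]

theorem sum_smul_stdVec {m : ℕ} (x : Euc m) : ∑ j, x j • stdVec j = x := by
  ext i; simp [stdVec, Finset.sum_apply, Pi.single_apply]

/-- Commutation of the Dirac operator with multiplication by the vector variable. -/
theorem dirac_vec_mul {m : ℕ} {f : Euc m → Cl m} {x : Euc m} (hf : DifferentiableAt ℝ f x) :
    dirac (fun y => vec y * f y) x =
      -((m : ℝ) • f x) - (2 : ℝ) • fderiv ℝ f x x - vec x * dirac f x := by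
  have hd := hasFDerivAt_vec_mul hf
  rw [dirac_eq_fderiv hd.differentiableAt, dirac_eq_fderiv hf, hd.fderiv]
  -- Moving `e_j` past `x` produces `-2 x_j`, which sums to the Euler operator; `e_j² = -1`
  -- contributes `-f` once per coordinate.
  have hterm : ∀ j, e j * ((mulCLM m).precompR (Euc m) (vec x) (fderiv ℝ f x) +
        (mulCLM m).precompL (Euc m) (vecCLM m) (f x)) (stdVec j) =
      -(2 : ℝ) • fderiv ℝ f x (x j • stdVec j) - vec x * (e j * fderiv ℝ f x (stdVec j)) - f x := by
    intro j
    have h1 : ((mulCLM m).precompR (Euc m) (vec x) (fderiv ℝ f x) +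
        (mulCLM m).precompL (Euc m) (vecCLM m) (f x)) (stdVec j) =
        vec x * fderiv ℝ f x (stdVec j) + e j * f x := rfl
    rw [h1, mul_add, ← mul_assoc, ← mul_assoc, e_mul_self, e_mul_vec, sub_mul, ← mul_assoc,
      ← Algebra.smul_def, map_smul, smul_smul]
    simp [sub_eq_add_neg]
  rw [Finset.sum_congr rfl fun j _ => hterm j]
  simp only [Finset.sum_sub_distrib, ← Finset.smul_sum, ← map_sum, ← Finset.mul_sum,
    sum_smul_stdVec]
  simp only [Finset.sum_const, Finset.card_univ, Fintype.card_fin, Nat.cast_smul_eq_nsmul]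
  module

/-- Euler's relation. -/
theorem fderiv_self_of_homogeneous {E F : Type*} [NormedAddCommGroup E] [NormedSpace ℝ E]
    [NormedAddCommGroup F] [NormedSpace ℝ F] {f : E → F} {d : ℕ}
    (h : ∀ (t : ℝ) x, f (t • x) = t ^ d • f x) {x : E} (hf : DifferentiableAt ℝ f x) :
    fderiv ℝ f x x = (d : ℝ) • f x := by
  have h1 : HasDerivAt (fun t : ℝ => f (t • x)) (fderiv ℝ f x x) 1 := by
    have hx : HasFDerivAt f (fderiv ℝ f x) ((1 : ℝ) • x) := by
      rw [one_smul]; exact hf.hasFDerivAt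
    have hl : HasDerivAt (fun t : ℝ => t • x) x 1 := by
      simpa using (hasDerivAt_id (1 : ℝ)).smul_const x
    exact hx.comp_hasDerivAt (1 : ℝ) hl
  have h2 : HasDerivAt (fun t : ℝ => f (t • x)) ((d : ℝ) • f x) 1 := by
    simp only [h]
    simpa using (hasDerivAt_pow d (1 : ℝ)).smul_const (f x)
  exact h1.unique h2

theorem eval_smul_of_isHomogeneous {σ R : Type*} [CommSemiring R] {p : MvPolynomial σ R} {k : ℕ}
    (hp : p.IsHomogeneous k) (t : R) (x : σ → R) :
    MvPolynomial.eval (fun i => t * x i) p = t ^ k * MvPolynomial.eval x p := by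
  rw [MvPolynomial.eval_eq, MvPolynomial.eval_eq, Finset.mul_sum]
  refine Finset.sum_congr rfl fun d hd => ?_
  have hdk := hp (MvPolynomial.mem_support_iff.1 hd)
  simp only [mul_pow, Finset.prod_mul_distrib, Finset.prod_pow_eq_pow_sum]
  have : ∑ i ∈ d.support, d i = k := by
    rw [← hdk, Finsupp.weight_apply, Finsupp.sum]; simp
  rw [this]; ring

theorem differentiable_mvPolynomial_eval {m : ℕ} (p : MvPolynomial (Fin m) ℝ) :
    Differentiable ℝ fun x : Euc m => MvPolynomial.eval (fun j => x j) p := by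
  induction p using MvPolynomial.induction_on with
  | C a => simp
  | add p q hp hq => simpa using hp.fun_add hq
  | mul_X p i hp =>
    have hi : Differentiable ℝ fun x : Euc m => x i := (EuclideanSpace.proj (𝕜 := ℝ) i).differentiable
    simpa using hp.fun_mul hi

theorem IsHomogeneousPolynomial.differentiable {m k : ℕ} {f : Euc m → Cl m}
    (hf : IsHomogeneousPolynomial k f) : Differentiable ℝ f := by
  obtain ⟨p, -, hp⟩ := hf
  rw [funext hp]
  exact Differentiable.fun_sum fun A _ => (differentiable_mvPolynomial_eval (p A)).smul_const _

theorem IsHomogeneousPolynomial.map_smul {m k : ℕ} {f : Euc m → Cl m}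
    (hf : IsHomogeneousPolynomial k f) (t : ℝ) (x : Euc m) : f (t • x) = t ^ k • f x := by
  obtain ⟨p, hh, hp⟩ := hf
  rw [hp, hp, Finset.smul_sum]
  refine Finset.sum_congr rfl fun A _ => ?_
  rw [smul_smul, ← eval_smul_of_isHomogeneous (hh A)]
  rfl

/-! ### The functions `p(x) Y(x)` and the Rodrigues formula. -/

/-- The function `p(x) Y(x)`, for a polynomial `p` in the vector variable `x`. -/
def polyMul {m : ℕ} (Y : Euc m → Cl m) (p : ℝ[X]) (x : Euc m) : Cl m := aeval (vec x) p * Y x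

section PolyMul

variable {m : ℕ} {Y : Euc m → Cl m}

theorem polyMul_add (p q : ℝ[X]) : polyMul Y (p + q) = polyMul Y p + polyMul Y q := by
  ext x; simp [polyMul, add_mul]

theorem polyMul_smul (c : ℝ) (p : ℝ[X]) : polyMul Y (c • p) = c • polyMul Y p := by
  ext x; simp [polyMul]

theorem polyMul_X_mul (p : ℝ[X]) : polyMul Y (X * p) = fun x => vec x * polyMul Y p x := by
  ext x; simp [polyMul, mul_assoc]

theorem polyMul_one : polyMul Y 1 = Y := by
  ext x; simp [polyMul]

theorem polyMul_one_add_sq_pow_mul (j : ℕ) (p : ℝ[X]) (x : Euc m) :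
    polyMul Y ((1 + X ^ 2) ^ j * p) x = (1 - ‖x‖ ^ 2) ^ j • polyMul Y p x := by
  have h : (1 : Cl m) + vec x ^ 2 = algebraMap ℝ (Cl m) (1 - ‖x‖ ^ 2) := by
    rw [pow_two, vec_mul_self]; simp [sub_eq_add_neg]
  simp only [polyMul, map_mul, map_pow, map_add, map_one, aeval_X]
  rw [h, ← map_pow, mul_assoc, Algebra.smul_def]

theorem polyMul_induction {P : (Euc m → Cl m) → Prop} (add : ∀ f g, P f → P g → P (f + g))
    (smul : ∀ (c : ℝ) f, P f → P (c • f)) (vec_mul : ∀ f, P f → P fun x => vec x * f x)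
    (hY : P Y) (p : ℝ[X]) : P (polyMul Y p) := by
  have hX : ∀ s : ℕ, P (polyMul Y (X ^ s)) := by
    intro s
    induction s with
    | zero => simpa [polyMul_one] using hY
    | succ s ih => rw [pow_succ', polyMul_X_mul]; exact vec_mul _ ih
  induction p using Polynomial.induction_on' with
  | add p q hp hq => rw [polyMul_add]; exact add _ _ hp hq
  | monomial s c =>
    rw [← C_mul_X_pow_eq_monomial, ← smul_eq_C_mul, polyMul_smul]; exact smul _ _ (hX s)

theorem differentiable_polyMul (hY : Differentiable ℝ Y) (p : ℝ[X]) :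
    Differentiable ℝ (polyMul Y p) :=
  polyMul_induction (P := Differentiable ℝ) (fun _ _ hf hg => hf.add hg)
    (fun c _ hf => hf.const_smul c)
    (fun _ hf x => (hasFDerivAt_vec_mul (hf x)).differentiableAt) hY p

theorem polyMul_X_pow_smul {k : ℕ} (hY : ∀ (t : ℝ) x, Y (t • x) = t ^ k • Y x) (s : ℕ) (t : ℝ)
    (x : Euc m) : polyMul Y (X ^ s) (t • x) = t ^ (s + k) • polyMul Y (X ^ s) x := by
  simp only [polyMul, map_pow, aeval_X, hY, map_smul, _root_.smul_pow, smul_mul_assoc,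
    mul_smul_comm, smul_smul, pow_add, mul_comm]

theorem dirac_add {f g : Euc m → Cl m} {x : Euc m} (hf : DifferentiableAt ℝ f x)
    (hg : DifferentiableAt ℝ g x) : dirac (f + g) x = dirac f x + dirac g x := by
  rw [dirac_eq_fderiv (hf.add hg), dirac_eq_fderiv hf, dirac_eq_fderiv hg, fderiv_add hf hg]
  simp [mul_add, Finset.sum_add_distrib]

theorem dirac_smul {f : Euc m → Cl m} {x : Euc m} (c : ℝ) (hf : DifferentiableAt ℝ f x) :
    dirac (c • f) x = c • dirac f x := by
  rw [dirac_eq_fderiv (hf.const_smul c), dirac_eq_fderiv hf, fderiv_const_smul hf]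
  simp [Finset.smul_sum]

theorem dirac_polyMul_X_pow {k : ℕ} (hY : IsSphericalMonogenic k Y) (s : ℕ) (x : Euc m) :
    dirac (polyMul Y (X ^ s)) x =
      -diracCoeff (2 * k + m) s • polyMul Y (X ^ (s - 1)) x := by
  have hd := hY.homogeneous.differentiable
  induction s with
  | zero => simp [polyMul_one, diracCoeff_zero, hY.monogenic]
  | succ s ih =>
    have hc := diracCoeff_succ_add (2 * k + m) s
    rw [pow_succ', polyMul_X_mul, dirac_vec_mul (differentiable_polyMul hd _ x), ih,
      fderiv_self_of_homogeneous (polyMul_X_pow_smul hY.homogeneous.map_smul s)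
        (differentiable_polyMul hd _ x), Nat.add_sub_cancel,
      show diracCoeff (2 * k + m) (s + 1) = 2 * s + (2 * k + m) - diracCoeff (2 * k + m) s by
        linarith, mul_smul_comm]
    have hs : diracCoeff (2 * k + m) s • (vec x * polyMul Y (X ^ (s - 1)) x) =
        diracCoeff (2 * k + m) s • polyMul Y (X ^ s) x := by
      rcases s with _ | s
      · simp [diracCoeff_zero]
      · rw [pow_succ', polyMul_X_mul, Nat.add_sub_cancel]
    rw [neg_smul, hs]
    push_cast
    module

theorem dirac_polyMul {k : ℕ} (hY : IsSphericalMonogenic k Y) (p : ℝ[X]) (x : Euc m) :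
    dirac (polyMul Y p) x = polyMul Y (polyDirac (2 * k + m) p) x := by
  have hd := differentiable_polyMul hY.homogeneous.differentiable
  induction p using Polynomial.induction_on' with
  | add p q hp hq =>
    rw [polyMul_add, dirac_add (hd p x) (hd q x), hp, hq, map_add, polyMul_add, Pi.add_apply]
  | monomial s c =>
    rw [polyDirac_monomial, ← C_mul_X_pow_eq_monomial, ← C_mul_X_pow_eq_monomial,
      ← smul_eq_C_mul, ← smul_eq_C_mul, polyMul_smul, polyMul_smul, dirac_smul _ (hd _ x),
      dirac_polyMul_X_pow hY, smul_smul, Pi.smul_apply, mul_comm]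

theorem dirac_congr {f g : Euc m → Cl m} {x : Euc m} (h : f =ᶠ[nhds x] g) :
    dirac f x = dirac g x := by
  simp only [dirac, h.lineDeriv_eq]

/-- The Rodrigues formula `C_{n,m}^j(Y) = (1 + x²)^(-j) ∂^n ((1 + x²)^(n+j) Y)`. -/
theorem smul_cliffordGegenbauer {k : ℕ} (hY : IsSphericalMonogenic k Y) (n j : ℕ) {x : Euc m}
    (hx : ‖x‖ < 1) :
    (1 - ‖x‖ ^ 2) ^ j • cliffordGegenbauer n j Y x =
      polyMul Y ((polyDirac (2 * k + m))^[n] ((1 + X ^ 2) ^ (n + j))) x := by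
  have hpos : ∀ y : Euc m, ‖y‖ < 1 → 0 < 1 - ‖y‖ ^ 2 := fun y hy => by
    have := norm_nonneg y
    nlinarith
  induction n generalizing j x with
  | zero =>
    have := polyMul_one_add_sq_pow_mul (Y := Y) j 1 x
    rw [mul_one, polyMul_one] at this
    simpa [cliffordGegenbauer] using this.symm
  | succ n ih =>
    -- The weight inside `D_j` is exactly the one in the induction hypothesis at `j + 1`. Equality
    -- on the open ball, a neighbourhood of `x`, suffices for differentiating.
    have hev : (fun y => (1 - ‖y‖ ^ 2) ^ ((j : ℝ) + 1) • cliffordGegenbauer n ((j : ℝ) + 1) Y y)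
        =ᶠ[nhds x] polyMul Y ((polyDirac (2 * k + m))^[n] ((1 + X ^ 2) ^ (n + 1 + j))) := by
      filter_upwards [(isOpen_lt continuous_norm continuous_const).mem_nhds hx] with y hy
      have := ih (j + 1) hy
      rw [show n + (j + 1) = n + 1 + j by ring] at this
      rw [← this, ← Nat.cast_succ, Real.rpow_natCast]
    rw [cliffordGegenbauer, gegenbauerOp, dirac_congr hev, dirac_polyMul hY,
      Real.rpow_neg (hpos x hx).le, Real.rpow_natCast, smul_smul,
      mul_inv_cancel₀ (pow_ne_zero _ (hpos x hx).ne'), one_smul, Function.iterate_succ_apply']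

theorem cliffordLegendre_eq {k : ℕ} (hY : IsSphericalMonogenic k Y) (n : ℕ) {x : Euc m}
    (hx : ‖x‖ < 1) :
    cliffordLegendre n Y x = polyMul Y ((polyDirac (2 * k + m))^[n] ((1 + X ^ 2) ^ n)) x := by
  simpa [cliffordLegendre] using smul_cliffordGegenbauer hY n 0 hx

/-! ### Pointwise inner products. -/

theorem inner_vec_mul (x : Euc m) (a b : Cl m) :
    inner ℝ (vec x * a) b = -inner ℝ a (vec x * b) := by
  change cliffordInner _ _ = -cliffordInner _ _
  simp [cliffordInner, star_mul, CliffordAlgebra.star_ι, mul_assoc]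

/-- Since `x` acts skew-adjointly, the adjoint of `p(x)` is `p(-x)`. -/
theorem inner_aeval_mul (p : ℝ[X]) (x : Euc m) (a b : Cl m) :
    inner ℝ (aeval (vec x) p * a) b = inner ℝ a (aeval (vec x) (p.comp (-X)) * b) := by
  have hX : ∀ (s : ℕ) (b : Cl m),
      inner ℝ (vec x ^ s * a) b = inner ℝ a ((-vec x) ^ s * b) := by
    intro s
    induction s with
    | zero => simp
    | succ s ih =>
      intro b
      rw [pow_succ', mul_assoc, inner_vec_mul, ih, pow_succ, mul_assoc, neg_mul, mul_neg,
        inner_neg_right]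
  induction p using Polynomial.induction_on' with
  | add p q hp hq => simp [add_mul, inner_add_left, inner_add_right, hp, hq]
  | monomial s c =>
    rw [monomial_comp, ← C_mul_X_pow_eq_monomial]
    simp [← Algebra.smul_def, inner_smul_left, inner_smul_right, hX]

theorem norm_sq_polyMul (p : ℝ[X]) (x : Euc m) :
    ‖polyMul Y p x‖ ^ 2 = inner ℝ (Y x) (polyMul Y (p.comp (-X) * p) x) := by
  rw [← real_inner_self_eq_norm_sq, polyMul, inner_aeval_mul, polyMul, map_mul, mul_assoc]

/-- Even powers of `x` are scalars; odd ones are skew-adjoint and drop out. In this pairing `x`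
behaves like `i|x|`. -/
theorem inner_vec_pow_mul (u : ℕ) (x : Euc m) (a : Cl m) :
    inner ℝ a (vec x ^ u * a) = (Complex.I ^ u).re * ‖x‖ ^ u * ‖a‖ ^ 2 := by
  have hsq : ∀ v, vec x ^ (2 * v) = algebraMap ℝ (Cl m) ((-1) ^ v * ‖x‖ ^ (2 * v)) := by
    intro v
    rw [pow_mul, pow_two, vec_mul_self, ← map_pow, neg_pow, pow_mul]
  rcases Nat.even_or_odd' u with ⟨v, rfl | rfl⟩
  · rw [hsq, ← Algebra.smul_def, real_inner_smul_right, real_inner_self_eq_norm_sq,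
      pow_mul Complex.I, Complex.I_sq, show ((-1 : ℂ) ^ v).re = (-1) ^ v by
        rcases neg_one_pow_eq_or ℂ v with h | h <;> rcases neg_one_pow_eq_or ℝ v with h' | h' <;>
          norm_cast]
  · have h0 : inner ℝ a (vec x * a) = 0 := by
      have := inner_vec_mul x a a
      rw [real_inner_comm] at this
      linarith
    rw [I_pow_re_of_odd ⟨v, rfl⟩, pow_succ, hsq, mul_assoc, ← Algebra.smul_def,
      real_inner_smul_right, h0]
    simp

end PolyMul

/-! ### Integration over the unit ball. -/

section BallIntegral

open Set Metric

theorem integral_Ioi_indicator_pow (d : ℕ) :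
    ∫ r in Ioi (0 : ℝ), (Iic (1 : ℝ)).indicator (fun r => r ^ d) r = 1 / (d + 1) := by
  rw [setIntegral_indicator measurableSet_Iic, Ioi_inter_Iic,
    ← intervalIntegral.integral_of_le zero_le_one, integral_pow]
  simp

/-- Integration of a homogeneous function over the unit ball in polar coordinates. -/
theorem setIntegral_closedBall_of_homogeneous {E : Type*} [NormedAddCommGroup E]
    [NormedSpace ℝ E] [FiniteDimensional ℝ E] [Nontrivial E] [MeasurableSpace E] [BorelSpace E]
    (ν : Measure E) [ν.IsAddHaarMeasure] {g : E → ℝ} {d : ℕ}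
    (hg : ∀ (t : ℝ) x, 0 < t → g (t • x) = t ^ d * g x) :
    ∫ x in closedBall (0 : E) 1, g x ∂ν =
      (∫ θ : sphere (0 : E) 1, g θ ∂ν.toSphere) / (d + Module.finrank ℝ E) := by
  have hpos : 0 < Module.finrank ℝ E := Module.finrank_pos
  rw [← integral_indicator measurableSet_closedBall]
  calc ∫ x, (closedBall (0 : E) 1).indicator g x ∂ν
      = ∫ x : ({(0)}ᶜ : Set E), (closedBall (0 : E) 1).indicator g x ∂(ν.comap (↑)) := by
        rw [integral_subtype_comap (measurableSet_singleton _).compl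
          fun x ↦ (closedBall (0 : E) 1).indicator g x, restrict_compl_singleton]
    _ = ∫ z : sphere (0 : E) 1 × Ioi (0 : ℝ),
          g z.1 * (Iic (1 : ℝ)).indicator (fun r => r ^ d) z.2
          ∂ν.toSphere.prod (.volumeIoiPow (Module.finrank ℝ E - 1)) := by
        rw [← ν.measurePreserving_homeomorphUnitSphereProd.integral_comp
          (Homeomorph.measurableEmbedding _)]
        refine integral_congr_ae (.of_forall fun x => ?_)
        have hx : 0 < ‖(x : E)‖ := norm_pos_iff.2 x.2
        simp only [homeomorphUnitSphereProd_apply_fst_coe, homeomorphUnitSphereProd_apply_snd_coe,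
          indicator, mem_closedBall_zero_iff, mem_Iic]
        split_ifs
        · rw [mul_comm, ← hg _ _ hx, smul_smul, mul_inv_cancel₀ hx.ne', one_smul]
        · simp
    _ = (∫ θ : sphere (0 : E) 1, g θ ∂ν.toSphere) *
          ∫ r : Ioi (0 : ℝ), (Iic (1 : ℝ)).indicator (fun r => r ^ d) (r : ℝ)
            ∂.volumeIoiPow (Module.finrank ℝ E - 1) :=
        integral_prod_mul (fun θ : sphere (0 : E) 1 => g θ)
          (fun r : Ioi (0 : ℝ) => (Iic (1 : ℝ)).indicator (fun r => r ^ d) (r : ℝ))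
    _ = (∫ θ : sphere (0 : E) 1, g θ ∂ν.toSphere) *
          ∫ r in Ioi (0 : ℝ),
            (Iic (1 : ℝ)).indicator (fun r => r ^ (d + (Module.finrank ℝ E - 1))) r := by
        simp only [Measure.volumeIoiPow, ENNReal.ofReal]
        rw [integral_withDensity_eq_integral_smul
            ((measurable_subtype_coe.pow_const _).real_toNNReal),
          integral_subtype_comap measurableSet_Ioi fun a : ℝ ↦
            Real.toNNReal (a ^ (Module.finrank ℝ E - 1)) •
              (Iic (1 : ℝ)).indicator (fun r => r ^ d) a]
        congr 1
        refine setIntegral_congr_fun measurableSet_Ioi fun r hr => ?_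
        simp only [NNReal.smul_def, Real.coe_toNNReal _ (pow_nonneg (le_of_lt hr) _), indicator]
        split_ifs
        · rw [smul_eq_mul, ← pow_add, add_comm]
        · simp
    _ = _ := by
        rw [integral_Ioi_indicator_pow, mul_one_div]
        congr 1
        -- The exponents match because the dimension is positive, so the truncated `finrank - 1` is
        -- genuine.
        rw [← Nat.cast_add, ← Nat.cast_succ]
        congr 1
        omega

variable {m k : ℕ} {Y : Euc m → Cl m}

/-- In dimension zero the sphere measure is zero, so the integral cannot be `1`. -/
theorem pos_of_isNormalizedOnSphere (hY : IsNormalizedOnSphere Y) : 0 < m := by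
  rcases Nat.eq_zero_or_pos m with rfl | h
  · have hs : (volume : Measure (Euc 0)).toSphere = 0 := by
      rw [Measure.toSphere_eq_zero_iff]; infer_instance
    simp [IsNormalizedOnSphere, hs] at hY
  · exact h

/-- For `p = X^u` the integrand is homogeneous of degree `u + 2k`, and the radial integral supplies
`1 / (u + 2k + m)`. -/
theorem setIntegral_inner_polyMul (hY : IsSphericalMonogenic k Y) (hnorm : IsNormalizedOnSphere Y)
    (p : ℝ[X]) :
    ∫ x in closedBall (0 : Euc m) 1, inner ℝ (Y x) (polyMul Y p x) =
      ballMoment (2 * k + m) p := by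
  have hm := pos_of_isNormalizedOnSphere hnorm
  have : Nonempty (Fin m) := ⟨⟨0, hm⟩⟩
  have hd := hY.homogeneous.differentiable
  have hint : ∀ p : ℝ[X], IntegrableOn (fun x => inner ℝ (Y x) (polyMul Y p x))
      (closedBall (0 : Euc m) 1) := fun p =>
    (hd.continuous.inner (differentiable_polyMul hd p).continuous).continuousOn.integrableOn_compact
      (isCompact_closedBall _ _)
  induction p using Polynomial.induction_on' with
  | add p q hp hq =>
    simp only [polyMul_add, Pi.add_apply, inner_add_right]
    rw [integral_add (hint p) (hint q), hp, hq, map_add]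
  | monomial u c =>
    have hpt : ∀ x, inner ℝ (Y x) (polyMul Y (monomial u c) x) =
        (c * (Complex.I ^ u).re) * (‖x‖ ^ u * ‖Y x‖ ^ 2) := by
      intro x
      rw [← C_mul_X_pow_eq_monomial, ← smul_eq_C_mul, polyMul_smul, Pi.smul_apply,
        real_inner_smul_right, polyMul, map_pow, aeval_X, inner_vec_pow_mul]
      ring
    have hhom : ∀ (t : ℝ) (x : Euc m), 0 < t →
        ‖t • x‖ ^ u * ‖Y (t • x)‖ ^ 2 = t ^ (u + 2 * k) * (‖x‖ ^ u * ‖Y x‖ ^ 2) := by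
      intro t x ht
      rw [hY.homogeneous.map_smul, norm_smul, norm_smul, norm_pow, Real.norm_of_nonneg ht.le]
      ring
    have hsph : ∫ θ : sphere (0 : Euc m) 1, ‖(θ : Euc m)‖ ^ u * ‖Y θ‖ ^ 2
        ∂(volume : Measure (Euc m)).toSphere = 1 := by
      have := hnorm
      rw [IsNormalizedOnSphere] at this
      simpa using this
    simp only [hpt]
    rw [integral_const_mul, setIntegral_closedBall_of_homogeneous volume hhom, hsph,
      ballMoment_monomial]
    simp
    ring

/-- The Rodrigues formula covers only `|x| < 1`; the boundary sphere is a null set. -/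
theorem cliffordLegendre_ae_eq (hY : IsSphericalMonogenic k Y) (hm : 0 < m) (n : ℕ) :
    cliffordLegendre n Y =ᵐ[volume.restrict (closedBall (0 : Euc m) 1)]
      polyMul Y ((polyDirac (2 * k + m))^[n] ((1 + X ^ 2) ^ n)) := by
  have : Nonempty (Fin m) := ⟨⟨0, hm⟩⟩
  have hs : ∀ᵐ x : Euc m, x ∉ sphere (0 : Euc m) 1 :=
    measure_eq_zero_iff_ae_notMem.1 (Measure.addHaar_sphere volume _ _)
  filter_upwards [ae_restrict_mem measurableSet_closedBall, ae_restrict_of_ae hs] with x hx hx'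
  refine cliffordLegendre_eq hY n ?_
  rw [mem_closedBall_zero_iff] at hx
  rw [mem_sphere_zero_iff_norm] at hx'
  exact lt_of_le_of_ne hx hx'

end BallIntegral

end CliffordLegendre

end

theorem mainTheorem7 {m : ℕ} (n k : ℕ) (Y : Euc m → Cl m)
    (hY : IsSphericalMonogenic k Y) (hnorm : IsNormalizedOnSphere Y) :
    MemLp (cliffordLegendre n Y) 2 (volume.restrict (Metric.closedBall (0 : Euc m) 1)) ∧
      ∫ x in Metric.closedBall (0 : Euc m) 1, ‖cliffordLegendre n Y x‖ ^ 2 =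
        2 ^ (2 * n) * (n.factorial : ℝ) ^ 2 / (2 * (k : ℝ) + 2 * (n : ℝ) + (m : ℝ)) := by
  have hm := pos_of_isNormalizedOnSphere hnorm
  have hae := cliffordLegendre_ae_eq hY hm n
  have hc := (differentiable_polyMul hY.homogeneous.differentiable
    ((polyDirac (2 * k + m))^[n] ((1 + Polynomial.X ^ 2) ^ n))).continuous
  constructor
  · rw [memLp_congr_ae hae, memLp_two_iff_integrable_sq_norm hc.aestronglyMeasurable]
    exact (hc.norm.pow 2).continuousOn.integrableOn_compact (isCompact_closedBall _ _)
  · have hμ : (0 : ℝ) < 2 * k + m := by positivity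
    have hcongr : (fun x => ‖cliffordLegendre n Y x‖ ^ 2)
        =ᵐ[volume.restrict (Metric.closedBall (0 : Euc m) 1)] fun x =>
          ‖polyMul Y ((polyDirac (2 * k + m))^[n] ((1 + Polynomial.X ^ 2) ^ n)) x‖ ^ 2 :=
      hae.fun_comp fun y => ‖y‖ ^ 2
    rw [integral_congr_ae hcongr]
    simp only [norm_sq_polyMul]
    rw [setIntegral_inner_polyMul hY hnorm, ballMoment_legendre hμ]
    ring
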